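/- An oriented graph is a directed graph without self-loops and directed $2$-cycles; its underlying graph is obtained by forgetting the directions of the arcs. Pushing a vertex $x$ reverses every arc incident to $x$. In the game with $k$ cops with strong push ability on an oriented graph $\overrightarrow{G}$, the cops first choose their starting vertices (several may share a vertex), then the robber chooses its starting vertex, and then the players alternate, cops first. In the cops' turn each cop either stays where it is, or moves to an out-neighbour of its current vertex, or pushes an arbitrary vertex of the graph; in the robber's turn the robber either stays or moves to an out-neighbour of its current vertex, with respect to the current orientation. The players have complete information. The cops win if after finitely many rounds some cop occupies the same vertex as the robber; otherwise the robber wins. Let $\mathsf{c_{sp}}(\overrightarrow{G})$ be the minimum $k$ such that $k$ cops have a winning strategy in this game. Theorem. Let $\overrightarrow{G}$ be an oriented graph whose underlying graph $G$ is finite and connected (in particular, non-empty). If $G$ has maximum degree $\Delta(G) \le 4$, then $\mathsf{c_{sp}}(\overrightarrow{G}) = 1$. -/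

import Mathlib

/-- A digraph is an oriented graph if it has no self-loops and no `2`-cycles
(taking `u = v` excludes the self-loops). -/
def Digraph.IsOriented {V : Type*} (D : Digraph V) : Prop :=
  ∀ u v, D.Adj u v → ¬ D.Adj v u

/-- The push operation on the vertex `x`: every arc incident to `x` is reversed. -/
def Digraph.push {V : Type*} (D : Digraph V) (x : V) : Digraph V where
  Adj u v := ((u = x ∨ v = x) ∧ D.Adj v u) ∨ (¬ (u = x ∨ v = x) ∧ D.Adj u v)

namespace StrongPushGame

/-- What a cop does in its turn: go to the vertex `u`, or push the vertex `x`.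
Staying put is going to the current vertex. -/
inductive CopAction (V : Type*) where
  | move (u : V) : CopAction V
  | push (x : V) : CopAction V

/-- A position of the game with `k` cops: the current orientation, the vertices of the cops and
the vertex of the robber. -/
structure Position (V : Type*) (k : ℕ) where
  graph : Digraph V
  cops : Fin k → V
  robber : V

variable {V : Type*} {k : ℕ}

/-- A cop at `c` with strong push ability may go to a vertex of the closed out-neighbourhood
of `c`, or push any vertex of the graph. -/
def CopAction.Legal (D : Digraph V) (c : V) : CopAction V → Prop
  | .move u => u = c ∨ D.Adj c u
  | .push _ => True

/-- The vertex of a cop, previously at `c`, after its action. -/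
def CopAction.newVertex (c : V) : CopAction V → V
  | .move u => u
  | .push _ => c

/-- The effect of an action on the orientation. -/
def CopAction.newGraph (D : Digraph V) : CopAction V → Digraph V
  | .move _ => D
  | .push x => D.push x

/-- The cops' vertices after a joint action `a`. -/
def copsAfter (p : Position V k) (a : Fin k → CopAction V) : Fin k → V :=
  fun i => (a i).newVertex (p.cops i)

/-- The orientation after a joint action `a`: all the chosen pushes are carried out
(pushes commute, so that their order is immaterial). -/
def graphAfter (p : Position V k) (a : Fin k → CopAction V) : Digraph V :=
  (List.ofFn a).foldl CopAction.newGraph p.graph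

/-- A deterministic strategy of `k` cops: initial vertices, and for each turn a legal joint
action, depending on the current position `p` and the list of all earlier positions. -/
structure Strategy (V : Type*) (k : ℕ) where
  start : Fin k → V
  act : List (Position V k) → Position V k → Fin k → CopAction V
  legal : ∀ past p i, (act past p i).Legal p.graph (p.cops i)

/-- The joint action that the strategy prescribes in round `n`, when the position at the start
of each round `m` is `P m`. -/
def Strategy.actionAt (σ : Strategy V k) (P : ℕ → Position V k) (n : ℕ) : Fin k → CopAction V :=
  σ.act ((List.range n).map P) (P n)

/-- `P` is a play on `D` in which the cops follow `σ`; `P n` is the position at the start of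
round `n`, with the cops to act. The robber chooses its first vertex freely once the cops are
placed; in each round the cops act and then the robber stays or goes to an out-neighbour
with respect to the orientation that the cops have left. (A play is continued after a capture;
what happens then does not matter.) -/
structure Strategy.IsPlay (σ : Strategy V k) (D : Digraph V) (P : ℕ → Position V k) : Prop where
  graph_zero : (P 0).graph = D
  cops_zero : (P 0).cops = σ.start
  graph_succ : ∀ n, (P (n + 1)).graph = graphAfter (P n) (σ.actionAt P n)
  cops_succ : ∀ n, (P (n + 1)).cops = copsAfter (P n) (σ.actionAt P n)
  robber_succ : ∀ n, (P (n + 1)).robber = (P n).robber ∨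
    (P (n + 1)).graph.Adj (P n).robber (P (n + 1)).robber

/-- The robber is captured in the play `P` in round `n`: a cop is on the robber's vertex either
at the start of the round, or right after the cops have acted in it. -/
def CapturedAt (P : ℕ → Position V k) (n : ℕ) : Prop :=
  ∃ i, (P n).cops i = (P n).robber ∨ (P (n + 1)).cops i = (P n).robber

/-- `σ` is a winning strategy on `D`: however the robber plays, it is captured after finitely
many rounds. -/
def Strategy.IsWinning (σ : Strategy V k) (D : Digraph V) : Prop :=
  ∀ P, σ.IsPlay D P → ∃ n, CapturedAt P n

end StrongPushGame

/-- The cop number of `D` when the cops have strong push ability: the least number of cops with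
a winning strategy. (On a finite vertex set such a number exists, since one cop on each
vertex captures the robber at once.) -/
noncomputable def Digraph.strongPushCopNumber {V : Type*} (D : Digraph V) : ℕ :=
  sInf {k : ℕ | ∃ σ : StrongPushGame.Strategy V k, σ.IsWinning D}

/-!
One cop wins by controlling the robber through pushes. The robber is lost on a sink, because
the cop can walk to it (`Wins.of_sink`), and hence on a vertex with a single out-neighbour, which
the cop may push (`Wins.of_outSet_subsingleton`). So the robber must leave at once whenever the
cop makes its out-degree equal to `1`, and since a push of the robber's own vertex exchanges its
in- and out-degree, the bound `4` on the degrees allows the cop to do this at every position.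

Suppose that the robber has just gone from `u` to `v` while `u` had at most two out-neighbours.
If `v` has in-degree at most `1`, pushing `v` leaves only the way back to `u`, which has become a
losing vertex (`Wins.of_inSet_subsingleton`). Hence a surviving robber has exactly two
out-neighbours and two in-neighbours at `v`, and in this case the cop can drive it to any
neighbour `w ≠ u` of `v` of its choice, again with at most two out-neighbours of `v` at that
time (`Evasive.step`).

The darts `(u, v)` that the robber can survive are therefore closed under non-backtracking steps.
A count of the darts starting and ending at each vertex shows that a non-empty such set has
darts ending at every vertex (`SimpleGraph.exists_dart_to_of_nonbacktracking_closed`), in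
particular at the vertex of the cop, where the robber is captured.
-/

/-! ### Non-backtracking walks in finite graphs -/

namespace SimpleGraph

/-- In a finite graph, let `B` be a set of darts closed under non-backtracking steps and without
dead ends. Then `B` has no first dart either: at each vertex at least as many darts of `B`
start as end, and summing over the vertices these numbers agree. -/
theorem exists_dart_pred_of_nonbacktracking_closed {V : Type*} [Finite V] (G : SimpleGraph V)
    (B : V → V → Prop) (hadj : ∀ u v, B u v → G.Adj u v)
    (hstep : ∀ u v w, B u v → G.Adj v w → w ≠ u → B v w)
    (hexit : ∀ u v, B u v → ∃ w, w ≠ u ∧ G.Adj v w) {u v : V} (h : B u v) : ∃ t, B t u := by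
  classical
  have := Fintype.ofFinite V
  have hle : ∀ y ∈ (Finset.univ : Finset V),
      (Finset.univ.filter fun x => B x y).card ≤ (Finset.univ.filter fun z => B y z).card := by
    intro y _
    by_cases h2 : ∃ x x', x ≠ x' ∧ B x y ∧ B x' y
    · -- Two darts of `B` ending at `y` give every dart starting at `y`.
      obtain ⟨x, x', hne, hx, hx'⟩ := h2
      refine Finset.card_le_card fun z hz => ?_
      simp only [Finset.mem_filter, Finset.mem_univ, true_and] at hz ⊢
      by_cases hzx : z = x
      · exact hstep x' y z hx' (hadj z y hz).symm (hzx ▸ hne)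
      · exact hstep x y z hx (hadj z y hz).symm hzx
    · by_cases h1 : ∃ x, B x y
      · obtain ⟨x, hx⟩ := h1
        obtain ⟨w, hwx, hyw⟩ := hexit x y hx
        calc (Finset.univ.filter fun x => B x y).card ≤ 1 := by
              refine Finset.card_le_one.2 fun a ha b hb => ?_
              simp only [Finset.mem_filter, Finset.mem_univ, true_and] at ha hb
              by_contra hab
              exact h2 ⟨a, b, hab, ha, hb⟩
          _ ≤ _ := Finset.card_pos.2 ⟨w, by simpa using hstep x y w hx hyw hwx⟩
      · have : (Finset.univ.filter fun x => B x y) = ∅ :=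
          Finset.filter_eq_empty_iff.2 fun x _ hx => h1 ⟨x, hx⟩
        simp [this]
  have hsum : ∑ y : V, (Finset.univ.filter fun x => B x y).card =
      ∑ y : V, (Finset.univ.filter fun z => B y z).card := by
    simp only [Finset.card_filter]
    exact Finset.sum_comm
  have hu := (Finset.sum_eq_sum_iff_of_le hle).1 hsum u (Finset.mem_univ u)
  have hpos : 0 < (Finset.univ.filter fun z => B u z).card :=
    Finset.card_pos.2 ⟨v, by simpa using h⟩
  rw [← hu] at hpos
  obtain ⟨t, ht⟩ := Finset.card_pos.1 hpos
  exact ⟨t, by simpa using ht⟩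

/-- A non-empty set of darts closed under non-backtracking steps and without dead ends has a
dart ending at each vertex, provided the graph is finite and connected. -/
theorem exists_dart_to_of_nonbacktracking_closed {V : Type*} [Finite V] {G : SimpleGraph V}
    (hG : G.Connected) (B : V → V → Prop) (hadj : ∀ u v, B u v → G.Adj u v)
    (hstep : ∀ u v w, B u v → G.Adj v w → w ≠ u → B v w)
    (hexit : ∀ u v, B u v → ∃ w, w ≠ u ∧ G.Adj v w) {u v : V} (h : B u v) (c : V) :
    ∃ x, B x c := by
  have key : ∀ {a b : V}, G.Walk a b → (∃ x, B x a) → ∃ x, B x b := by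
    intro a b p
    induction p with
    | nil => exact id
    | @cons a y b hay p ih =>
      rintro ⟨x, hx⟩
      apply ih
      by_cases hyx : y = x
      · exact hyx ▸ G.exists_dart_pred_of_nonbacktracking_closed B hadj hstep hexit hx
      · exact ⟨a, hstep x a y hx hay hyx⟩
  obtain ⟨p⟩ := hG.preconnected v c
  exact key p ⟨u, h⟩

end SimpleGraph

/-! ### Orientations of a simple graph and pushes -/

namespace Digraph

variable {V : Type*}

/-- `D` is an orientation of the simple graph `G`. -/
structure IsOrientationOf (D : Digraph V) (G : SimpleGraph V) : Prop where
  oriented : D.IsOriented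
  adj_iff : ∀ u v, G.Adj u v ↔ D.Adj u v ∨ D.Adj v u

theorem IsOriented.isOrientationOf {D : Digraph V} (h : D.IsOriented) :
    D.IsOrientationOf D.toSimpleGraphInclusive where
  oriented := h
  adj_iff u v := by
    simp only [toSimpleGraphInclusive, SimpleGraph.fromRel_adj, and_iff_right_iff_imp]
    rintro (h' | h') rfl <;> exact h _ _ h' h'

theorem IsOrientationOf.push {D : Digraph V} {G : SimpleGraph V} (h : D.IsOrientationOf G)
    (x : V) : (D.push x).IsOrientationOf G where
  oriented u v := by
    have h1 := h.oriented u v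
    have h2 := h.oriented v u
    simp only [Digraph.push]
    tauto
  adj_iff u v := by
    rw [h.adj_iff]
    simp only [Digraph.push]
    tauto

/-- The set of out-neighbours of `v`. -/
def outSet (D : Digraph V) (v : V) : Set V := {w | D.Adj v w}

/-- The set of in-neighbours of `v`. -/
def inSet (D : Digraph V) (v : V) : Set V := {w | D.Adj w v}

theorem outSet_push_self (D : Digraph V) (v : V) : (D.push v).outSet v = D.inSet v := by
  ext w
  simp [outSet, inSet, Digraph.push]

theorem push_adj_of_ne (D : Digraph V) {x u v : V} (hu : u ≠ x) (hv : v ≠ x) :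
    (D.push x).Adj u v ↔ D.Adj u v := by
  simp [Digraph.push, hu, hv]

theorem push_adj_left (D : Digraph V) (x v : V) : (D.push x).Adj x v ↔ D.Adj v x := by
  simp [Digraph.push]

theorem push_adj_right (D : Digraph V) (x v : V) : (D.push x).Adj v x ↔ D.Adj x v := by
  simp [Digraph.push]

theorem IsOriented.ne {D : Digraph V} (h : D.IsOriented) {u v : V} (huv : D.Adj u v) : u ≠ v := by
  rintro rfl
  exact h _ _ huv huv

/-- Pushing an out-neighbour `x` of `v` removes `x`, and nothing else, from the out-neighbours. -/
theorem IsOriented.outSet_push {D : Digraph V} (h : D.IsOriented) {v x : V} (hvx : D.Adj v x) :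
    (D.push x).outSet v = D.outSet v \ {x} := by
  ext w
  by_cases hw : w = x
  · subst hw
    simpa [outSet, push_adj_right] using h _ _ hvx
  · simp [outSet, push_adj_of_ne D (h.ne hvx) hw, hw]

theorem IsOriented.encard_outSet_push_le {D : Digraph V} (h : D.IsOriented) {v x : V}
    (hvx : D.Adj v x) (h2 : (D.outSet v).encard ≤ 2) : ((D.push x).outSet v).encard ≤ 1 := by
  rw [h.outSet_push hvx]
  rw [← Set.encard_sdiff_singleton_add_one (show x ∈ D.outSet v from hvx),
    ← one_add_one_eq_two] at h2
  exact (ENat.add_le_add_iff_right ENat.one_ne_top).1 h2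

theorem IsOrientationOf.encard_outSet_add_encard_inSet {D : Digraph V} {G : SimpleGraph V}
    (h : D.IsOrientationOf G) (v : V) :
    (D.outSet v).encard + (D.inSet v).encard = (G.neighborSet v).encard := by
  rw [← Set.encard_union_eq]
  · congr 1
    ext w
    simp [outSet, inSet, h.adj_iff]
  · exact Set.disjoint_left.2 fun w hw hw' => h.oriented _ _ hw hw'

end Digraph

/-! ### Positions won by a single cop -/

namespace StrongPushGame

variable {V : Type*}

/-- A single cop at `c`, to act on the orientation `D` with the robber at `r`, can force a
capture within `n` rounds. -/
def WinsIn : ℕ → Digraph V → V → V → Prop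
  | 0, _, c, r => c = r
  | n + 1, D, c, r => c = r ∨ ∃ a : CopAction V, a.Legal D c ∧
      (a.newVertex c = r ∨ ∀ r', r' = r ∨ (a.newGraph D).Adj r r' →
        WinsIn n (a.newGraph D) (a.newVertex c) r')

/-- A single cop at `c`, to act on `D` with the robber at `r`, can force a capture. -/
def Wins (D : Digraph V) (c r : V) : Prop := ∃ n, WinsIn n D c r

theorem WinsIn.succ {n : ℕ} {D : Digraph V} {c r : V} (h : WinsIn n D c r) :
    WinsIn (n + 1) D c r := by
  induction n generalizing D c r with
  | zero => exact Or.inl h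
  | succ n ih =>
    rcases h with h | ⟨a, ha, h⟩
    · exact Or.inl h
    · exact Or.inr ⟨a, ha, h.imp_right fun h r' hr' => ih (h r' hr')⟩

theorem WinsIn.mono {m n : ℕ} (hmn : m ≤ n) {D : Digraph V} {c r : V} (h : WinsIn m D c r) :
    WinsIn n D c r := by
  induction hmn with
  | refl => exact h
  | step _ ih => exact ih.succ

theorem Wins.self (D : Digraph V) (c : V) : Wins D c c := ⟨0, rfl⟩

theorem Wins.of_adj {D : Digraph V} {c r : V} (h : D.Adj c r) : Wins D c r :=
  ⟨1, Or.inr ⟨.move r, Or.inr h, Or.inl rfl⟩⟩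

theorem Wins.of_action [Finite V] {D : Digraph V} {c r : V} (a : CopAction V) (ha : a.Legal D c)
    (h : ∀ r', r' = r ∨ (a.newGraph D).Adj r r' → Wins (a.newGraph D) (a.newVertex c) r') :
    Wins D c r := by
  -- The robber has finitely many replies, so that the numbers of rounds have a common bound.
  have := Fintype.ofFinite V
  choose! f hf using h
  exact ⟨Finset.univ.sup f + 1, Or.inr ⟨a, ha, Or.inr fun r' hr' =>
    (hf r' hr').mono (Finset.le_sup (Finset.mem_univ r'))⟩⟩

/-- The cop wins by pushing `x` if it wins after each reply of the robber. -/
theorem Wins.of_push [Finite V] {D : Digraph V} {c r : V} (x : V) (hstay : Wins (D.push x) c r)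
    (hmove : ∀ r' ∈ (D.push x).outSet r, Wins (D.push x) c r') : Wins D c r := by
  refine Wins.of_action (.push x) trivial ?_
  rintro r' (rfl | h)
  · exact hstay
  · exact hmove r' h

/-- A choice of winning actions turns winning positions into a winning strategy. -/
theorem exists_isWinning_of_wins {D : Digraph V} {c : V} (h : ∀ r, Wins D c r) :
    ∃ σ : Strategy V 1, σ.IsWinning D := by
  classical
  -- If `n + 1` is the least number of rounds that suffices, the cop plays an action after which
  -- `n` rounds suffice, so that this number decreases along every play.
  have hact : ∀ p : Position V 1, ∃ a : CopAction V, a.Legal p.graph (p.cops 0) ∧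
      ∀ n, WinsIn (n + 1) p.graph (p.cops 0) p.robber → ¬ WinsIn n p.graph (p.cops 0) p.robber →
        p.cops 0 = p.robber ∨ a.newVertex (p.cops 0) = p.robber ∨
          ∀ r', r' = p.robber ∨ (a.newGraph p.graph).Adj p.robber r' →
            WinsIn n (a.newGraph p.graph) (a.newVertex (p.cops 0)) r' := by
    intro p
    by_cases hp : ∃ n, WinsIn (n + 1) p.graph (p.cops 0) p.robber ∧
        ¬ WinsIn n p.graph (p.cops 0) p.robber
    · obtain ⟨n, hn, hn'⟩ := hp
      have huniq : ∀ m, WinsIn (m + 1) p.graph (p.cops 0) p.robber →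
          ¬ WinsIn m p.graph (p.cops 0) p.robber → m = n := by
        intro m hm hm'
        by_contra hne
        rcases Nat.lt_or_gt_of_ne hne with hlt | hlt
        · exact hn' (hm.mono hlt)
        · exact hm' (hn.mono hlt)
      rcases hn with hn | ⟨a, ha, hn⟩
      · exact ⟨.move (p.cops 0), Or.inl rfl, fun _ _ _ => Or.inl hn⟩
      · refine ⟨a, ha, fun m hm hm' => Or.inr ?_⟩
        rw [huniq m hm hm']
        exact hn
    · exact ⟨.move (p.cops 0), Or.inl rfl, fun n hn hn' => absurd ⟨n, hn, hn'⟩ hp⟩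
  choose act hlegal hwin using hact
  let σ : Strategy V 1 :=
    { start := fun _ => c
      act := fun _ p _ => act p
      legal := fun _ p i => by rw [Subsingleton.elim i 0]; exact hlegal p }
  refine ⟨σ, fun P hP => ?_⟩
  have key : ∀ n m, WinsIn n (P m).graph ((P m).cops 0) (P m).robber → ∃ m, CapturedAt P m := by
    intro n
    induction n with
    | zero => exact fun m hm => ⟨m, 0, Or.inl hm⟩
    | succ n ih =>
      intro m hm
      by_cases hm' : WinsIn n (P m).graph ((P m).cops 0) (P m).robber
      · exact ih m hm'
      have hg : (P (m + 1)).graph = (act (P m)).newGraph (P m).graph := by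
        rw [hP.graph_succ]
        simp [graphAfter, Strategy.actionAt, σ]
      have hc : (P (m + 1)).cops 0 = (act (P m)).newVertex ((P m).cops 0) := by
        rw [hP.cops_succ]
        rfl
      rcases hwin (P m) n hm hm' with h0 | h0 | h0
      · exact ⟨m, 0, Or.inl h0⟩
      · exact ⟨m, 0, Or.inr (hc.trans h0)⟩
      · refine ih (m + 1) ?_
        have hr := hP.robber_succ m
        rw [hg] at hr
        rw [hg, hc]
        exact h0 _ hr
  obtain ⟨n, hn⟩ := h (P 0).robber
  refine key n 0 ?_
  rw [hP.graph_zero, hP.cops_zero]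
  exact hn

/-- Without cops the robber is never captured, say by staying where it is. -/
theorem not_isWinning_of_no_cops [Nonempty V] (D : Digraph V) (σ : Strategy V 0) :
    ¬ σ.IsWinning D := by
  intro h
  obtain ⟨n, i, -⟩ := h (fun _ => ⟨D, σ.start, Classical.arbitrary V⟩)
    { graph_zero := rfl
      cops_zero := rfl
      graph_succ := fun n => by simp [graphAfter]
      cops_succ := fun n => Subsingleton.elim _ _
      robber_succ := fun n => Or.inl rfl }
  exact i.elim0

theorem strongPushCopNumber_eq_one [Nonempty V] {D : Digraph V} {c : V} (h : ∀ r, Wins D c r) :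
    D.strongPushCopNumber = 1 := by
  have hmem := exists_isWinning_of_wins h
  apply le_antisymm (Nat.sInf_le hmem)
  rw [Nat.one_le_iff_ne_zero]
  intro h0
  rcases Nat.sInf_eq_zero.1 h0 with ⟨σ, hσ⟩ | hempty
  · exact not_isWinning_of_no_cops D σ hσ
  · exact hempty.subset hmem

/-! ### Driving the robber -/

variable [Finite V] {G : SimpleGraph V} {D : Digraph V} {c r : V}

/-- A robber on a sink is lost. The cop walks to it, pushing its own vertex whenever the next arc
points the wrong way; a cop next to the robber needs no push, so the robber stays on a sink. -/
theorem Wins.of_sink (p : G.Walk c r) (hD : D.IsOrientationOf G) (hr : D.outSet r = ∅) :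
    Wins D c r := by
  induction p generalizing D with
  | nil => exact .self _ _
  | @cons c u r hcu p ih =>
    have hmove : ∀ {E : Digraph V}, E.IsOrientationOf G → E.outSet r = ∅ → E.Adj c u →
        Wins E c r := by
      intro E hE hEr hEcu
      refine .of_action (.move u) (Or.inr hEcu) ?_
      rintro r' (rfl | h)
      · exact ih hE hEr
      · exact absurd h (Set.eq_empty_iff_forall_notMem.1 hEr r')
    by_cases hcr : c = r
    · exact hcr ▸ .self _ _
    by_cases hadj : G.Adj c r
    · exact .of_adj (((hD.adj_iff c r).1 hadj).resolve_right
        (Set.eq_empty_iff_forall_notMem.1 hr c))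
    rcases (hD.adj_iff c u).1 hcu with h | h
    · exact hmove hD hr h
    · have hr' : (D.push c).outSet r = ∅ := by
        refine Set.eq_empty_iff_forall_notMem.2 fun w hw => ?_
        by_cases hwc : w = c
        · subst hwc
          exact hadj ((hD.adj_iff _ _).2 (Or.inl ((D.push_adj_right w r).1 hw)))
        · exact Set.eq_empty_iff_forall_notMem.1 hr w
            ((D.push_adj_of_ne (Ne.symm hcr) hwc).1 hw)
      refine .of_push c (hmove (hD.push c) hr' ((D.push_adj_left c u).2 h)) ?_
      simp [hr']

/-- A robber on a vertex of out-degree at most `1` is lost: pushing the out-neighbour leaves it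
on a sink. -/
theorem Wins.of_outSet_subsingleton (hG : G.Connected) (hD : D.IsOrientationOf G)
    (h : (D.outSet r).encard ≤ 1) : Wins D c r := by
  obtain ⟨p⟩ := hG.preconnected c r
  rcases Set.encard_le_one_iff_eq.1 h with h | ⟨w, h⟩
  · exact .of_sink p hD h
  · have hsink : (D.push w).outSet r = ∅ := by
      rw [hD.oriented.outSet_push (show w ∈ D.outSet r by simp [h]), h, Set.sdiff_self]
    refine .of_push w (.of_sink p (hD.push w) hsink) ?_
    simp [hsink]

/-- If the robber came from `u`, where it had at most two out-neighbours, to a vertex `r` of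
in-degree at most `1`, it is lost: pushing `r` leaves only the way back to `u`, which now has
out-degree at most `1`. -/
theorem Wins.of_inSet_subsingleton (hG : G.Connected) (hD : D.IsOrientationOf G) {u : V}
    (hur : D.Adj u r) (hu : (D.outSet u).encard ≤ 2) (h : (D.inSet r).encard ≤ 1) :
    Wins D c r := by
  refine .of_push r (.of_outSet_subsingleton hG (hD.push r) ?_) fun w hw => ?_
  · rwa [D.outSet_push_self]
  · rw [D.outSet_push_self] at hw
    obtain rfl : w = u := Set.encard_le_one_iff.1 h _ _ hw hur
    exact .of_outSet_subsingleton hG (hD.push r)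
      (hD.oriented.encard_outSet_push_le hur hu)

/-- The dart `(u, v)` is evasive for a cop at `c` if, for some orientation with at most two
out-neighbours of `u`, the robber escapes after going from `u` to `v`. -/
def Evasive (G : SimpleGraph V) (c u v : V) : Prop :=
  ∃ D : Digraph V, D.IsOrientationOf G ∧ D.Adj u v ∧ (D.outSet u).encard ≤ 2 ∧ ¬ Wins D c v

/-- With two out-neighbours `w` and `b` of the robber's vertex, pushing `b` drives the robber
to `w`. -/
theorem Wins.of_drive (hG : G.Connected) (hD : D.IsOrientationOf G) {w b : V}
    (hw : D.Adj r w) (hb : D.Adj r b) (hbw : w ≠ b) (h2 : (D.outSet r).encard ≤ 2)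
    (hwin : ∀ E : Digraph V, E.IsOrientationOf G → E.Adj r w → (E.outSet r).encard ≤ 2 →
      Wins E c w) : Wins D c r := by
  have h1 := hD.oriented.encard_outSet_push_le hb h2
  have hw' : (D.push b).Adj r w := (D.push_adj_of_ne (hD.oriented.ne hb) hbw).2 hw
  refine .of_push b (.of_outSet_subsingleton hG (hD.push b) h1) fun x hx => ?_
  obtain rfl : x = w := Set.encard_le_one_iff.1 h1 _ _ hx hw'
  exact hwin _ (hD.push b) hw' (h1.trans one_le_two)

/-- When an evasive dart `(u, v)` has been traversed, `v` has two out-neighbours and two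
in-neighbours. -/
theorem encard_eq_two_of_not_wins (hG : G.Connected) (hdeg : ∀ v, (G.neighborSet v).encard ≤ 4)
    (hD : D.IsOrientationOf G) {u v : V} (huv : D.Adj u v) (hu : (D.outSet u).encard ≤ 2)
    (hwin : ¬ Wins D c v) : (D.outSet v).encard = 2 ∧ (D.inSet v).encard = 2 := by
  have ho : ¬ (D.outSet v).encard ≤ 1 := fun h => hwin (.of_outSet_subsingleton hG hD h)
  have hi : ¬ (D.inSet v).encard ≤ 1 := fun h => hwin (.of_inSet_subsingleton hG hD huv hu h)
  have hsum := (hD.encard_outSet_add_encard_inSet v).trans_le (hdeg v)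
  rw [← (D.outSet v).toFinite.cast_ncard_eq] at *
  rw [← (D.inSet v).toFinite.cast_ncard_eq] at *
  norm_cast at *
  omega

theorem Evasive.exists_adj_ne (hG : G.Connected) (hdeg : ∀ v, (G.neighborSet v).encard ≤ 4)
    {u v : V} (h : Evasive G c u v) : ∃ w, w ≠ u ∧ G.Adj v w := by
  obtain ⟨D, hD, huv, hu, hwin⟩ := h
  have ho := (encard_eq_two_of_not_wins hG hdeg hD huv hu hwin).1
  obtain ⟨w, hw⟩ : (D.outSet v).Nonempty := by
    rw [← Set.encard_ne_zero, ho]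
    exact two_ne_zero
  refine ⟨w, ?_, (hD.adj_iff v w).2 (Or.inl hw)⟩
  rintro rfl
  exact hD.oriented _ _ huv hw

/-- After an evasive dart `(u, v)` the cop can drive the robber to each neighbour `w ≠ u` of `v`.
If `w` is an out-neighbour, it pushes the other one. Otherwise `u` and `w` are the two
in-neighbours; the cop pushes `v`, after which `u` is a losing reply, and then, if the robber has
stayed, pushes `u`. -/
theorem Evasive.step (hG : G.Connected) (hdeg : ∀ v, (G.neighborSet v).encard ≤ 4)
    {u v w : V} (h : Evasive G c u v) (hvw : G.Adj v w) (hwu : w ≠ u) : Evasive G c v w := by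
  obtain ⟨D, hD, huv, hu, hwin⟩ := h
  obtain ⟨ho, hi⟩ := encard_eq_two_of_not_wins hG hdeg hD huv hu hwin
  by_contra hE
  have key : ∀ E : Digraph V, E.IsOrientationOf G → E.Adj v w → (E.outSet v).encard ≤ 2 →
      Wins E c w := by
    intro E hEG hEvw hEv
    by_contra hEw
    exact hE ⟨E, hEG, hEvw, hEv, hEw⟩
  apply hwin
  rcases (hD.adj_iff v w).1 hvw with h | h
  · obtain ⟨b, hb, hbw⟩ := Set.exists_ne_of_one_lt_encard
      (show 1 < (D.outSet v).encard by rw [ho]; norm_num) w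
    exact .of_drive hG hD h hb hbw.symm ho.le key
  · have hout : (D.push v).outSet v = D.inSet v := D.outSet_push_self v
    have hw' : (D.push v).Adj v w := (D.push_adj_left v w).2 h
    have hu' : (D.push v).Adj v u := (D.push_adj_left v u).2 huv
    have h2 : ((D.push v).outSet v).encard ≤ 2 := by rw [hout, hi]
    refine .of_push v (.of_drive hG (hD.push v) hw' hu' hwu h2 key) fun x hx => ?_
    by_cases hxu : x = u
    · subst hxu
      exact .of_outSet_subsingleton hG (hD.push v) (hD.oriented.encard_outSet_push_le huv hu)
    · -- `x` and `w` both remain once `u` is removed from the two out-neighbours.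
      have h1 := (hD.push v).oriented.encard_outSet_push_le hu' h2
      rw [(hD.push v).oriented.outSet_push hu'] at h1
      obtain rfl : x = w := Set.encard_le_one_iff.1 h1 _ _ ⟨hx, hxu⟩ ⟨hw', hwu⟩
      exact key _ (hD.push v) hw' h2

/-- There are no evasive darts: otherwise, by non-backtracking drives, one of them would end at
the cop's vertex. -/
theorem not_evasive (hG : G.Connected) (hdeg : ∀ v, (G.neighborSet v).encard ≤ 4) (u v : V) :
    ¬ Evasive G c u v := by
  intro h
  obtain ⟨x, D, -, -, -, hwin⟩ := SimpleGraph.exists_dart_to_of_nonbacktracking_closed hG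
    (Evasive G c) (fun u v ⟨_, hD, huv, _⟩ => (hD.adj_iff u v).2 (Or.inl huv))
    (fun _ _ _ h => h.step hG hdeg) (fun _ _ h => h.exists_adj_ne hG hdeg) h c
  exact hwin (.self D c)

/-- One cop wins from every position: a single push leaves the robber at most one out-neighbour,
and going there is not evasive. -/
theorem wins_of_encard_neighborSet_le_four (hG : G.Connected)
    (hdeg : ∀ v, (G.neighborSet v).encard ≤ 4) (hD : D.IsOrientationOf G) : Wins D c r := by
  have key : ∀ x, ((D.push x).outSet r).encard ≤ 1 → Wins D c r := by
    refine fun x h1 => .of_push x (.of_outSet_subsingleton hG (hD.push x) h1) fun w hw => ?_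
    by_contra hwin
    exact not_evasive hG hdeg r w ⟨D.push x, hD.push x, hw, h1.trans one_le_two, hwin⟩
  by_cases h2 : (D.outSet r).encard ≤ 2
  · rcases (D.outSet r).eq_empty_or_nonempty with h0 | ⟨x, hx⟩
    · exact .of_outSet_subsingleton hG hD (by simp [h0])
    · exact key x (hD.oriented.encard_outSet_push_le hx h2)
  · apply key r
    have hsum := (hD.encard_outSet_add_encard_inSet r).trans_le (hdeg r)
    rw [D.outSet_push_self]
    rw [← (D.outSet r).toFinite.cast_ncard_eq] at *
    rw [← (D.inSet r).toFinite.cast_ncard_eq] at *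
    norm_cast at *
    omega

end StrongPushGame

theorem mainTheorem3 {V : Type*} [Fintype V] (D : Digraph V) (hD : D.IsOriented)
    [DecidableRel D.toSimpleGraphInclusive.Adj]
    (hconn : D.toSimpleGraphInclusive.Connected)
    (hdeg : D.toSimpleGraphInclusive.maxDegree ≤ 4) :
    D.strongPushCopNumber = 1 := by
  have := hconn.nonempty
  refine StrongPushGame.strongPushCopNumber_eq_one (c := Classical.arbitrary V) fun r =>
    StrongPushGame.wins_of_encard_neighborSet_le_four hconn (fun v => ?_) hD.isOrientationOf
  rw [Set.encard_eq_coe_toFinset_card]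
  exact_mod_cast (D.toSimpleGraphInclusive.degree_le_maxDegree v).trans hdeg
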